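/- Let $(Z,d)$ be a complete separable metric space, and write $\mathcal P(X)$ for the set of Borel probability measures on a space $X$. For finite Borel measures $\nu_1,\nu_2$ on a space $E$ and $\omega\colon E\times E\to[0,\infty]$ measurable, let $\mathcal T_\omega(\nu_1,\nu_2)=\inf_N\int\omega\,dN$, where $N$ runs over all couplings of $\nu_1$ and $\nu_2$, i.e. measures on $E\times E$ with marginals $\nu_1,\nu_2$ (so that $\mathcal T_\omega(\nu_1,\nu_2)=\infty$ if $\nu_1(E)\neq\nu_2(E)$). For $\nu,\gamma\in\mathcal P(E)$, let $\mathcal H(\nu|\gamma)=\int\log\frac{d\nu}{d\gamma}\,d\nu$ if $\nu\ll\gamma$, and $\mathcal H(\nu|\gamma)=\infty$ otherwise. Let $\mathcal M_{\mathbb N}(Z)=\{\sum_{i=1}^k\delta_{z_i}: k\in\mathbb N,\ z_1,\dots,z_k\in Z\}$ (with $0\in\mathbb N$) be the space of finite configurations, equipped with the weak topology and its Borel $\sigma$-field. For $\Pi_1,\Pi_2\in\mathcal P(\mathcal M_{\mathbb N}(Z))$ and $\rho\colon Z\times Z\to[0,\infty]$ lower semi-continuous, let $\mathbb T_\rho(\Pi_1,\Pi_2)=\inf\mathbb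 E[\mathcal T_\rho(\xi_1,\xi_2)]$, where the infimum runs over the couples $(\xi_1,\xi_2)$ of point processes with $\xi_1\sim\Pi_1$ and $\xi_2\sim\Pi_2$. For $\mu\in\mathcal P(Z)$ and $\kappa\in\mathcal P(\mathbb N)$, let $B_{\mu,\kappa}\in\mathcal P(\mathcal M_{\mathbb N}(Z))$ be the law of the mixed binomial process $\sum_{i=1}^N\delta_{X_i}$, where $(X_i)_{i\ge1}$ are i.i.d. of law $\mu$ and $N$ has law $\kappa$ and is independent of $(X_i)_{i\ge1}$. **Theorem.** Let $\kappa\in\mathcal P(\mathbb N)$, $\mu\in\mathcal P(Z)$, let $\rho\colon Z\times Z\to[0,\infty]$ be lower semi-continuous, and let $a_1,a_2\in(0,\infty]$, with the convention $0\cdot\infty=0$. Assume that $$\mathcal T_\rho(\nu_1,\nu_2)\le a_1\mathcal H(\nu_1|\mu)+a_2\mathcal H(\nu_2|\mu)\qquad\text{for all }\nu_1,\nu_2\in\mathcal P(Z).$$ Then, for all $\Pi_1,\Pi_2\in\mathcal P(\mathcal M_{\mathbb N}(Z))$ such that $\mathbb T_\rho(\Pi_1,\Pi_2)<\infty$, the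 law of the total mass $\eta(Z)$ is the same under $\Pi_1$ and $\Pi_2$, i.e. there is $\lambda\in\mathcal P(\mathbb N)$ with $\Pi_i(\{\eta:\eta(Z)\in A\})=\lambda(A)$ for all $A\subset\mathbb N$ and $i\in\{1,2\}$, and $$\mathbb T_\rho(\Pi_1,\Pi_2)+(a_1+a_2)\,\mathcal H(\lambda|\kappa)\le a_1\mathcal H(\Pi_1|B_{\mu,\kappa})+a_2\mathcal H(\Pi_2|B_{\mu,\kappa}).$$ -/

import Mathlib

open MeasureTheory Topology
open scoped ENNReal NNReal

/-- The space `𝓜_ℕ(Z)` of finite configurations: the finite measures on `Z` of the form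
`∑ i < k, δ_{a i}` with `k ∈ ℕ` (the zero measure for `k = 0`, repetitions being allowed). -/
def Configuration (Z : Type*) [MeasurableSpace Z] : Type _ :=
  {ξ : FiniteMeasure Z // ∃ (k : ℕ) (a : Fin k → Z), (ξ : Measure Z) = ∑ i, Measure.dirac (a i)}

namespace Configuration

/-- The measure on `Z` underlying a configuration. -/
def toMeasure {Z : Type*} [MeasurableSpace Z] (ξ : Configuration Z) : Measure Z :=
  (ξ.1 : Measure Z)

/-- The weak topology: the trace on configurations of the weak topology of finite measures. -/
noncomputable instance instTopologicalSpace {Z : Type*} [TopologicalSpace Z] [MeasurableSpace Z]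
    [OpensMeasurableSpace Z] : TopologicalSpace (Configuration Z) :=
  TopologicalSpace.induced (fun ξ : Configuration Z => ξ.1) inferInstance

/-- The configuration space carries the Borel sigma-field of its weak topology. -/
noncomputable instance instMeasurableSpace {Z : Type*} [TopologicalSpace Z] [MeasurableSpace Z]
    [OpensMeasurableSpace Z] : MeasurableSpace (Configuration Z) :=
  borel (Configuration Z)

instance instBorelSpace {Z : Type*} [TopologicalSpace Z] [MeasurableSpace Z]
    [OpensMeasurableSpace Z] : BorelSpace (Configuration Z) :=
  ⟨rfl⟩

/-- The configuration `∑ i < k, δ_{a i}` of the points `a 0, …, a (k - 1)`. -/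
noncomputable def ofPoints {Z : Type*} [MeasurableSpace Z] {k : ℕ} (a : Fin k → Z) :
    Configuration Z :=
  ⟨⟨∑ i, Measure.dirac (a i), inferInstance⟩, k, a, rfl⟩

theorem continuous_ofPoints {Z : Type*} [TopologicalSpace Z] [MeasurableSpace Z]
    [OpensMeasurableSpace Z] (k : ℕ) :
    Continuous (ofPoints : (Fin k → Z) → Configuration Z) := by
  refine continuous_induced_rng.2 (continuous_iff_continuousAt.2 fun a => ?_)
  refine FiniteMeasure.tendsto_iff_forall_lintegral_tendsto.2 fun f => ?_
  have key : ∀ b : Fin k → Z,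
      ∫⁻ x, (f x : ℝ≥0∞) ∂((ofPoints b).1 : Measure Z) = ∑ i, (f (b i) : ℝ≥0∞) := by
    intro b
    have hf : Measurable fun x => (f x : ℝ≥0∞) :=
      (ENNReal.continuous_coe.comp f.continuous).measurable
    change ∫⁻ x, (f x : ℝ≥0∞) ∂(∑ i, Measure.dirac (b i)) = _
    rw [lintegral_finsetSum_measure]
    exact Finset.sum_congr rfl fun i _ => lintegral_dirac' _ hf
  simp only [Function.comp_apply, key]
  refine tendsto_finsetSum _ fun i _ => ?_
  exact ((ENNReal.continuous_coe.comp f.continuous).comp (continuous_apply i)).continuousAt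

end Configuration

/-- The random configuration `∑ i < N, δ_{X i}` as a function of `(N, (X i)_i)`. -/
noncomputable def mixedBinomialMap {Z : Type*} [MeasurableSpace Z] (p : ℕ × (ℕ → Z)) :
    Configuration Z :=
  Configuration.ofPoints (fun i : Fin p.1 => p.2 i)

theorem measurable_mixedBinomialMap {Z : Type*} [TopologicalSpace Z]
    [SecondCountableTopology Z] [MeasurableSpace Z] [BorelSpace Z] :
    Measurable (mixedBinomialMap : ℕ × (ℕ → Z) → Configuration Z) := by
  refine measurable_from_prod_countable_right fun n => ?_
  refine ((Configuration.continuous_ofPoints n).comp ?_).measurable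
  exact continuous_pi fun i : Fin n => continuous_apply (A := fun _ : ℕ => Z) (i : ℕ)

/-- The mixed binomial process law `B_{μ,κ}`: the law of `∑ i < N, δ_{X i}`, where `N` has law
`κ` and `(X i)` is an i.i.d. sequence of law `μ` independent of `N`. -/
noncomputable def mixedBinomial {Z : Type*} [TopologicalSpace Z] [MeasurableSpace Z]
    [OpensMeasurableSpace Z] (μ : Measure Z) [IsProbabilityMeasure μ] (κ : Measure ℕ) :
    Measure (Configuration Z) :=
  (κ.prod (Measure.infinitePi fun _ : ℕ => μ)).map mixedBinomialMap

/-- `N` is a coupling of the finite measures `ν₁` and `ν₂`. -/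
def IsCoupling {E : Type*} [MeasurableSpace E] (N : Measure (E × E)) (ν₁ ν₂ : Measure E) : Prop :=
  N.map Prod.fst = ν₁ ∧ N.map Prod.snd = ν₂

/-- The optimal transport cost `𝓣_ω(ν₁, ν₂)`, the infimum of `∫ ω dN` over all couplings `N` of
the finite measures `ν₁` and `ν₂`; it is `∞` if there is no coupling, that is, if the total masses
differ. -/
noncomputable def transportCost {E : Type*} [MeasurableSpace E] (ω : E × E → ℝ≥0∞)
    (ν₁ ν₂ : Measure E) : ℝ≥0∞ :=
  ⨅ (N : Measure (E × E)) (_ : IsCoupling N ν₁ ν₂), ∫⁻ p, ω p ∂N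

/-- The transport-entropy inequality `(T_ω)` for `γ` with constants `a₁`, `a₂` in `(0, ∞]`, under
the convention `0 · ∞ = 0`. For probability measures `klDiv ν γ` is the relative entropy. -/
def TransportEntropyInequality {E : Type*} [MeasurableSpace E] (ω : E × E → ℝ≥0∞)
    (a₁ a₂ : ℝ≥0∞) (γ : Measure E) : Prop :=
  ∀ ν₁ ν₂ : Measure E, IsProbabilityMeasure ν₁ → IsProbabilityMeasure ν₂ →
    transportCost ω ν₁ ν₂ ≤
      a₁ * InformationTheory.klDiv ν₁ γ + a₂ * InformationTheory.klDiv ν₂ γ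

/-- The process-level transport cost `𝕋_ρ`: the transport cost between laws of point processes
for the cost function `(ξ₁, ξ₂) ↦ 𝓣_ρ(ξ₁, ξ₂)` on configurations. -/
noncomputable def processTransportCost {Z : Type*} [TopologicalSpace Z] [MeasurableSpace Z]
    [OpensMeasurableSpace Z] (ρ : Z × Z → ℝ≥0∞) (P₁ P₂ : Measure (Configuration Z)) : ℝ≥0∞ :=
  transportCost (fun ξ : Configuration Z × Configuration Z =>
    transportCost ρ ξ.1.toMeasure ξ.2.toMeasure) P₁ P₂

/-!
The transport-entropy inequality is carried from `Z` to the space of configurations in three moves.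

*Tensorization.* On `Z ^ n` with the cost `∑ i, ρ (x i, y i)` the law `μ ^ n` satisfies the
inequality with the same constants. The usual induction couples the first coordinates and then,
given these, the conditional laws of the others, which in general requires a measurable choice of
couplings. Here `ρ` is first replaced by Lipschitz costs increasing to it (`lipschitzApprox`). For
a Lipschitz cost the first coordinate may be discretized with an arbitrarily small error: only
countably many conditional laws remain (`transportCost_compProd_le`), the entropy does not increase
under the discretization (`klDiv_map_le`), and it splits by the chain rule
(`klDiv_add_lintegral_klDiv_le`); a coupling of the discretized laws is lifted back in
`transportCost_le_transportCost_map_add`. The Lipschitz costs are removed at the end by the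
compactness of the set of couplings (`TransportEntropyInequality.iSup`).

*Push-forward.* The inequality passes to image measures when the cost does not increase
(`TransportEntropyInequality.map`), because a density with respect to the image lifts without
changing the entropy. Applied to `(x i) ↦ ∑ i, δ_{x i}`, this gives the inequality for the binomial
process with `n` points.

*Mixing.* A coupling of finite cost charges only pairs of configurations with equally many points,
so the two point processes share the law `l` of the number of points. The entropy of each relative
to the mixed binomial process dominates `klDiv l κ` plus the `l`-average of the conditional
entropies given the number of points, and coupling the conditional laws for each number of points
yields the claim.
-/

open ProbabilityTheory InformationTheory Filter

/-! ### Transport costs and couplings -/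

theorem IsCoupling.isProbabilityMeasure {E : Type*} [MeasurableSpace E] {N : Measure (E × E)}
    {ν₁ ν₂ : Measure E} [IsProbabilityMeasure ν₁] (h : IsCoupling N ν₁ ν₂) :
    IsProbabilityMeasure N := by
  constructor
  rw [← measure_univ (μ := ν₁), ← h.1, Measure.map_apply measurable_fst MeasurableSet.univ,
    Set.preimage_univ]

theorem IsCoupling.prod {E : Type*} [MeasurableSpace E] (ν₁ ν₂ : Measure E)
    [IsProbabilityMeasure ν₁] [IsProbabilityMeasure ν₂] : IsCoupling (ν₁.prod ν₂) ν₁ ν₂ := by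
  constructor <;> simp [Measure.map_fst_prod, Measure.map_snd_prod]

theorem IsCoupling.map {E F : Type*} [MeasurableSpace E] [MeasurableSpace F] {N : Measure (E × E)}
    {ν₁ ν₂ : Measure E} (h : IsCoupling N ν₁ ν₂) {g : E → F} (hg : Measurable g) :
    IsCoupling (N.map (Prod.map g g)) (ν₁.map g) (ν₂.map g) := by
  constructor
  · rw [Measure.map_map measurable_fst (hg.prodMap hg), ← h.1, Measure.map_map hg measurable_fst]
    rfl
  · rw [Measure.map_map measurable_snd (hg.prodMap hg), ← h.2, Measure.map_map hg measurable_snd]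
    rfl

theorem transportCost_le_of_isCoupling {E : Type*} [MeasurableSpace E] {ω : E × E → ℝ≥0∞}
    {ν₁ ν₂ : Measure E} {N : Measure (E × E)} (h : IsCoupling N ν₁ ν₂) :
    transportCost ω ν₁ ν₂ ≤ ∫⁻ p, ω p ∂N :=
  iInf₂_le N h

/-- Near-optimal couplings exist, also when the transport cost is infinite. -/
theorem exists_isCoupling_lintegral_le {E : Type*} [MeasurableSpace E] (ω : E × E → ℝ≥0∞)
    (ν₁ ν₂ : Measure E) [IsProbabilityMeasure ν₁] [IsProbabilityMeasure ν₂] {ε : ℝ≥0∞}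
    (hε : ε ≠ 0) :
    ∃ N, IsCoupling N ν₁ ν₂ ∧ ∫⁻ p, ω p ∂N ≤ transportCost ω ν₁ ν₂ + ε := by
  by_cases h : transportCost ω ν₁ ν₂ = ∞
  · exact ⟨_, IsCoupling.prod ν₁ ν₂, by simp [h]⟩
  · obtain ⟨N, hN⟩ := iInf_lt_iff.1 (ENNReal.lt_add_right h hε)
    obtain ⟨hN, hlt⟩ := iInf_lt_iff.1 hN
    exact ⟨N, hN, hlt.le⟩

/-- No measurability of the costs is needed: under a push-forward, the lower integral of an
arbitrary function can only decrease. -/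
theorem transportCost_map_le {E F : Type*} [MeasurableSpace E] [MeasurableSpace F]
    {ω : E × E → ℝ≥0∞} {c : F × F → ℝ≥0∞} {g : E → F} (hg : Measurable g)
    (hc : ∀ x y, c (g x, g y) ≤ ω (x, y)) (ν₁ ν₂ : Measure E) :
    transportCost c (ν₁.map g) (ν₂.map g) ≤ transportCost ω ν₁ ν₂ :=
  le_iInf₂ fun _ hN => (transportCost_le_of_isCoupling (hN.map hg)).trans <|
    (lintegral_map_le _ _).trans (lintegral_mono fun p => hc p.1 p.2)

/-! ### Relative entropy -/

theorem klDiv_withDensity {E : Type*} [MeasurableSpace E] (ν : Measure E) [IsFiniteMeasure ν]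
    {f : E → ℝ≥0∞} (hf : Measurable f) [IsFiniteMeasure (ν.withDensity f)] :
    klDiv (ν.withDensity f) ν = ∫⁻ x, ENNReal.ofReal (klFun (f x).toReal) ∂ν := by
  rw [klDiv_eq_lintegral_klFun_of_ac (withDensity_absolutelyContinuous ν f)]
  refine lintegral_congr_ae ?_
  filter_upwards [Measure.rnDeriv_withDensity ν hf] with x hx
  rw [hx]

/-- The chain rule for the relative entropy over a countable first factor, with the conditional
entropy in integral form. -/
theorem klDiv_add_lintegral_klDiv_le {F : Type*} [MeasurableSpace F] (q r : Measure ℕ)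
    [IsFiniteMeasure q] [IsFiniteMeasure r] (K η : Kernel ℕ F) [IsMarkovKernel K]
    [IsMarkovKernel η] :
    klDiv q r + ∫⁻ i, klDiv (K i) (η i) ∂q ≤ klDiv (q ⊗ₘ K) (r ⊗ₘ η) := by
  rw [klDiv_compProd_eq_add]
  gcongr
  by_cases hac : q ⊗ₘ K ≪ q ⊗ₘ η
  swap
  · simp [klDiv_of_not_ac hac]
  set f := (q ⊗ₘ K).rnDeriv (q ⊗ₘ η) with hf
  have hfm : Measurable f := Measure.measurable_rnDeriv _ _
  -- on the atoms `i` of `q`, the section `f (i, ·)` is the density of `K i` with respect to `η i`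
  have hK : ∀ i, q {i} ≠ 0 → K i = (η i).withDensity fun y => f (i, y) := by
    intro i hi
    ext s hs
    have h1 : (q ⊗ₘ K) ({i} ×ˢ s) = q {i} * K i s := by
      rw [Measure.compProd_apply_prod (measurableSet_singleton i) hs, lintegral_singleton, mul_comm]
    have h2 : (q ⊗ₘ K) ({i} ×ˢ s) = q {i} * ∫⁻ y in s, f (i, y) ∂(η i) := by
      conv_lhs => rw [← Measure.withDensity_rnDeriv_eq _ _ hac]
      rw [withDensity_apply _ ((measurableSet_singleton i).prod hs),
        Measure.setLIntegral_compProd hfm (measurableSet_singleton i) hs, lintegral_singleton,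
        mul_comm]
    rw [withDensity_apply _ hs]
    exact (ENNReal.mul_right_inj hi (measure_ne_top q _)).1 (h1.symm.trans h2)
  rw [klDiv_eq_lintegral_klFun_of_ac hac, Measure.lintegral_compProd (by fun_prop)]
  refine lintegral_mono_ae ((ae_iff_of_countable).2 fun i hi => le_of_eq ?_)
  have : IsFiniteMeasure ((η i).withDensity fun y => f (i, y)) := hK i hi ▸ inferInstance
  conv_lhs => rw [hK i hi]
  exact klDiv_withDensity _ (by fun_prop)

/-! ### Transport-entropy inequalities under push-forward -/

/-- A measure absolutely continuous with respect to an image `μ.map g` is itself an image under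
`g`, of a measure with the same entropy relative to `μ`: pull back its density. -/
theorem exists_map_eq_klDiv_eq {E F : Type*} [MeasurableSpace E] [MeasurableSpace F]
    {μ : Measure E} [IsProbabilityMeasure μ] {g : E → F} (hg : Measurable g) {α : Measure F}
    [IsProbabilityMeasure α] (hα : α ≪ μ.map g) :
    ∃ Q : Measure E, IsProbabilityMeasure Q ∧ Q.map g = α ∧ klDiv Q μ = klDiv α (μ.map g) := by
  have : IsProbabilityMeasure (μ.map g) := Measure.isProbabilityMeasure_map hg.aemeasurable
  set f := α.rnDeriv (μ.map g) with hf
  have hfm : Measurable f := Measure.measurable_rnDeriv _ _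
  have hQ : (μ.withDensity (f ∘ g)).map g = α := by
    conv_rhs => rw [← Measure.withDensity_rnDeriv_eq _ _ hα]
    ext s hs
    rw [Measure.map_apply hg hs, withDensity_apply _ (hg hs), withDensity_apply _ hs,
      setLIntegral_map hs hfm hg]
    rfl
  have hprob : IsProbabilityMeasure (μ.withDensity (f ∘ g)) := by
    constructor
    rw [← measure_univ (μ := α), ← hQ, Measure.map_apply hg MeasurableSet.univ, Set.preimage_univ]
  refine ⟨_, hprob, hQ, ?_⟩
  rw [klDiv_withDensity μ (hfm.comp hg), klDiv_eq_lintegral_klFun_of_ac hα,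
    lintegral_map (by fun_prop) hg]
  rfl

theorem TransportEntropyInequality.map {E F : Type*} [MeasurableSpace E] [MeasurableSpace F]
    {ω : E × E → ℝ≥0∞} {c : F × F → ℝ≥0∞} {a₁ a₂ : ℝ≥0∞} (ha₁ : 0 < a₁) (ha₂ : 0 < a₂)
    {μ : Measure E} [IsProbabilityMeasure μ] (h : TransportEntropyInequality ω a₁ a₂ μ)
    {g : E → F} (hg : Measurable g) (hc : ∀ x y, c (g x, g y) ≤ ω (x, y)) :
    TransportEntropyInequality c a₁ a₂ (μ.map g) := by
  intro α₁ α₂ _ _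
  by_cases h₁ : α₁ ≪ μ.map g
  swap
  · simp [klDiv_of_not_ac h₁, ENNReal.mul_top ha₁.ne']
  by_cases h₂ : α₂ ≪ μ.map g
  swap
  · simp [klDiv_of_not_ac h₂, ENNReal.mul_top ha₂.ne']
  obtain ⟨Q₁, hQ₁, hm₁, hk₁⟩ := exists_map_eq_klDiv_eq hg h₁
  obtain ⟨Q₂, hQ₂, hm₂, hk₂⟩ := exists_map_eq_klDiv_eq hg h₂
  rw [← hk₁, ← hk₂, ← hm₁, ← hm₂]
  exact (transportCost_map_le hg hc Q₁ Q₂).trans (h Q₁ Q₂ hQ₁ hQ₂)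

theorem TransportEntropyInequality.mono {E : Type*} [MeasurableSpace E]
    {ω c : E × E → ℝ≥0∞} {a₁ a₂ : ℝ≥0∞} {μ : Measure E}
    (h : TransportEntropyInequality ω a₁ a₂ μ) (hc : c ≤ ω) :
    TransportEntropyInequality c a₁ a₂ μ := fun ν₁ ν₂ h₁ h₂ =>
  (iInf₂_mono fun _ _ => lintegral_mono hc).trans (h ν₁ ν₂ h₁ h₂)

/-! ### Mixtures over a countable index -/

theorem compProd_eq_sum_map {F : Type*} [MeasurableSpace F] (q : Measure ℕ) [SFinite q]
    (K : Kernel ℕ F) [IsSFiniteKernel K] :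
    q ⊗ₘ K = Measure.sum fun i => q {i} • (K i).map (Prod.mk i) := by
  ext s hs
  rw [Measure.compProd_apply hs, lintegral_countable', Measure.sum_apply _ hs]
  refine tsum_congr fun i => ?_
  rw [Measure.smul_apply, Measure.map_apply measurable_prodMk_left hs, smul_eq_mul, mul_comm]

/-- Summing the atoms of a measure on `ℕ × ℕ` against a family depending only on the image under
`g` gives the sum of the atoms of the image measure. -/
theorem sum_singleton_smul_comp {F : Type*} [MeasurableSpace F] (N : Measure (ℕ × ℕ))
    {g : ℕ × ℕ → ℕ} (m : ℕ → Measure F) :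
    (Measure.sum fun p => N {p} • m (g p)) = Measure.sum fun i => N.map g {i} • m i := by
  ext s hs
  rw [Measure.sum_apply _ hs, Measure.sum_apply _ hs]
  have h := lintegral_map (μ := N) (f := fun i => m i s) (g := g)
    (Measurable.of_discrete) (Measurable.of_discrete)
  rw [lintegral_countable', lintegral_countable'] at h
  simpa [mul_comm] using h.symm

/-- Couple the indices by `N` and, given the indices `(i, j)`, the components `K₁ i` and `K₂ j`
near-optimally. The cost `c` on indices may be infinite, in which case nothing has to be known
about the components. -/
theorem transportCost_compProd_le {F : Type*} [MeasurableSpace F] (q₁ q₂ : Measure ℕ)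
    [IsProbabilityMeasure q₁] [IsProbabilityMeasure q₂] (K₁ K₂ : Kernel ℕ F) [IsMarkovKernel K₁]
    [IsMarkovKernel K₂] (c : ℕ × ℕ → ℝ≥0∞) (ω : F × F → ℝ≥0∞) (A B : ℕ → ℝ≥0∞)
    (h : ∀ i j, c (i, j) ≠ ∞ → transportCost ω (K₁ i) (K₂ j) ≤ A i + B j) :
    transportCost (fun p : (ℕ × F) × (ℕ × F) => c (p.1.1, p.2.1) + ω (p.1.2, p.2.2))
        (q₁ ⊗ₘ K₁) (q₂ ⊗ₘ K₂) ≤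
      transportCost c q₁ q₂ + (∫⁻ i, A i ∂q₁ + ∫⁻ j, B j ∂q₂) := by
  refine ENNReal.le_of_forall_pos_le_add fun ε hε _ => ?_
  have hε2 : (ε / 2 : ℝ≥0∞) ≠ 0 := by simp [hε.ne']
  obtain ⟨N, hN, hNc⟩ := exists_isCoupling_lintegral_le c q₁ q₂ hε2
  have hNp := hN.isProbabilityMeasure
  have hM : ∀ p : ℕ × ℕ, ∃ M, IsCoupling M (K₁ p.1) (K₂ p.2) ∧
      c p + ∫⁻ y, ω y ∂M ≤ c p + (A p.1 + B p.2 + ε / 2) := by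
    intro p
    obtain ⟨M, hM, hle⟩ := exists_isCoupling_lintegral_le ω (K₁ p.1) (K₂ p.2) hε2
    refine ⟨M, hM, ?_⟩
    by_cases hc : c p = ∞
    · simp [hc]
    · gcongr
      exact hle.trans (by gcongr; exact h p.1 p.2 hc)
  choose M hMc hMle using hM
  let T : ℕ × ℕ → F × F → (ℕ × F) × (ℕ × F) := fun p y => ((p.1, y.1), (p.2, y.2))
  have hT : ∀ p, Measurable (T p) := fun p => by fun_prop
  let R : Measure ((ℕ × F) × (ℕ × F)) := Measure.sum fun p => N {p} • (M p).map (T p)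
  have hR : IsCoupling R (q₁ ⊗ₘ K₁) (q₂ ⊗ₘ K₂) := by
    constructor
    · rw [Measure.map_sum measurable_fst.aemeasurable, compProd_eq_sum_map, ← hN.1,
        ← sum_singleton_smul_comp]
      congr 1
      ext1 p
      rw [Measure.map_smul, Measure.map_map measurable_fst (hT p), ← (hMc p).1,
        Measure.map_map measurable_prodMk_left measurable_fst]
      rfl
    · rw [Measure.map_sum measurable_snd.aemeasurable, compProd_eq_sum_map, ← hN.2,
        ← sum_singleton_smul_comp]
      congr 1
      ext1 p
      rw [Measure.map_smul, Measure.map_map measurable_snd (hT p), ← (hMc p).2,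
        Measure.map_map measurable_prodMk_left measurable_snd]
      rfl
  calc transportCost _ (q₁ ⊗ₘ K₁) (q₂ ⊗ₘ K₂)
      ≤ ∑' p, N {p} * ∫⁻ y, (c (y.1.1, y.2.1) + ω (y.1.2, y.2.2)) ∂((M p).map (T p)) := by
        refine (transportCost_le_of_isCoupling hR).trans (le_of_eq ?_)
        rw [lintegral_sum_measure]
        simp
    _ ≤ ∑' p, (c p + (A p.1 + B p.2 + ε / 2)) * N {p} := by
        refine ENNReal.tsum_le_tsum fun p => ?_
        rw [mul_comm]
        gcongr
        refine (lintegral_map_le _ _).trans ?_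
        have : IsProbabilityMeasure (M p) := (hMc p).isProbabilityMeasure
        rw [lintegral_add_left (by fun_prop)]
        simpa [T] using hMle p
    _ = ∫⁻ p, c p ∂N + (∫⁻ i, A i ∂q₁ + ∫⁻ j, B j ∂q₂ + ε / 2) := by
        rw [← lintegral_countable', lintegral_add_left Measurable.of_discrete,
          lintegral_add_left Measurable.of_discrete, lintegral_add_left Measurable.of_discrete,
          ← hN.1, ← hN.2, lintegral_map Measurable.of_discrete measurable_fst,
          lintegral_map Measurable.of_discrete measurable_snd]
        simp
    _ ≤ transportCost c q₁ q₂ + ε / 2 + (∫⁻ i, A i ∂q₁ + ∫⁻ j, B j ∂q₂ + ε / 2) := by gcongr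
    _ = transportCost c q₁ q₂ + (∫⁻ i, A i ∂q₁ + ∫⁻ j, B j ∂q₂) + ε := by
        conv_rhs => rw [← ENNReal.add_halves (ε : ℝ≥0∞)]
        ring

/-! ### Lifting couplings -/

/-- If `ω` exceeds a cost on the images under `g` by at most `ε`, then so do the transport costs:
a coupling of the images is lifted by drawing the preimages from their conditional laws,
independently given the images. -/
theorem transportCost_le_transportCost_map_add {E F : Type*} [MeasurableSpace E]
    [StandardBorelSpace E] [Nonempty E] [MeasurableSpace F] [MeasurableEq F] {g : E → F}
    (hg : Measurable g) {ω : E × E → ℝ≥0∞} (hω : Measurable ω) {c : F × F → ℝ≥0∞} {ε : ℝ≥0∞}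
    (hc : ∀ x y, ω (x, y) ≤ c (g x, g y) + ε) (Q₁ Q₂ : Measure E) [IsProbabilityMeasure Q₁]
    [IsProbabilityMeasure Q₂] :
    transportCost ω Q₁ Q₂ ≤ transportCost c (Q₁.map g) (Q₂.map g) + ε := by
  have hdis : ∀ Q : Measure E, IsProbabilityMeasure Q → ∃ K : Kernel F E, IsMarkovKernel K ∧
      (∀ s, MeasurableSet s → ∫⁻ u, K u s ∂(Q.map g) = Q s) ∧
      ∀ᵐ u ∂(Q.map g), ∀ᵐ z ∂(K u), g z = u := by
    intro Q _
    have hgm : Measurable fun z => (g z, z) := by fun_prop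
    have hp : IsProbabilityMeasure (Q.map fun z => (g z, z)) :=
      Measure.isProbabilityMeasure_map hgm.aemeasurable
    set R := Q.map fun z => (g z, z) with hR
    have hfst : R.fst = Q.map g := by
      rw [Measure.fst, hR, Measure.map_map measurable_fst hgm]
      rfl
    have hRK : Q.map g ⊗ₘ R.condKernel = R := by
      rw [← hfst]
      exact R.disintegrate R.condKernel
    have hgp : IsProbabilityMeasure (Q.map g) := Measure.isProbabilityMeasure_map hg.aemeasurable
    refine ⟨R.condKernel, inferInstance, fun s hs => ?_, ?_⟩
    · have h := Measure.compProd_apply_prod (μ := Q.map g) (κ := R.condKernel) MeasurableSet.univ hs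
      rw [hRK, setLIntegral_univ] at h
      rw [← h, hR, Measure.map_apply hgm (MeasurableSet.univ.prod hs)]
      congr 1
      ext z
      simp
    · have hm : MeasurableSet {p : F × E | g p.2 = p.1} :=
        measurableSet_eq_fun (hg.comp measurable_snd) measurable_fst
      refine Measure.ae_ae_of_ae_compProd (p := fun p : F × E => g p.2 = p.1) ?_
      rw [hRK, hR, ae_map_iff hgm.aemeasurable hm]
      simp
  obtain ⟨K₁, _, hK₁, hK₁'⟩ := hdis Q₁ inferInstance
  obtain ⟨K₂, _, hK₂, hK₂'⟩ := hdis Q₂ inferInstance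
  rw [transportCost, transportCost, ENNReal.iInf_add]
  refine le_iInf fun N => ?_
  by_cases hN : IsCoupling N (Q₁.map g) (Q₂.map g)
  swap
  · simp [hN]
  simp only [hN, iInf_pos]
  have hgp : IsProbabilityMeasure (Q₁.map g) := Measure.isProbabilityMeasure_map hg.aemeasurable
  have hNp := hN.isProbabilityMeasure
  let K : Kernel (F × F) (E × E) := K₁.parallelComp K₂
  have hKa : ∀ p, K p = (K₁ p.1).prod (K₂ p.2) := fun p => Kernel.parallelComp_apply ..
  have hcoup : IsCoupling (N.bind K) Q₁ Q₂ := by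
    constructor
    · ext s hs
      rw [Measure.map_apply measurable_fst hs,
        Measure.bind_apply (measurable_fst hs) K.measurable.aemeasurable, ← hK₁ s hs, ← hN.1,
        lintegral_map (K₁.measurable_coe hs) measurable_fst]
      refine lintegral_congr fun p => ?_
      rw [hKa, ← Measure.map_apply measurable_fst hs, Measure.map_fst_prod]
      simp
    · ext s hs
      rw [Measure.map_apply measurable_snd hs,
        Measure.bind_apply (measurable_snd hs) K.measurable.aemeasurable, ← hK₂ s hs, ← hN.2,
        lintegral_map (K₂.measurable_coe hs) measurable_snd]
      refine lintegral_congr fun p => ?_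
      rw [hKa, ← Measure.map_apply measurable_snd hs, Measure.map_snd_prod]
      simp
  refine (transportCost_le_of_isCoupling (ω := ω) hcoup).trans ?_
  rw [Measure.lintegral_bind K.measurable.aemeasurable hω.aemeasurable]
  calc ∫⁻ p, ∫⁻ z, ω z ∂(K p) ∂N ≤ ∫⁻ p, (c p + ε) ∂N := by
        refine lintegral_mono_ae ?_
        rw [← hN.1] at hK₁'
        rw [← hN.2] at hK₂'
        filter_upwards [ae_of_ae_map measurable_fst.aemeasurable hK₁',
          ae_of_ae_map measurable_snd.aemeasurable hK₂'] with p h₁ h₂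
        rw [hKa, lintegral_prod _ hω.aemeasurable]
        calc ∫⁻ x, ∫⁻ y, ω (x, y) ∂(K₂ p.2) ∂(K₁ p.1)
            ≤ ∫⁻ _, ∫⁻ _, (c p + ε) ∂(K₂ p.2) ∂(K₁ p.1) := by
              refine lintegral_mono_ae ?_
              filter_upwards [h₁] with x hx
              refine lintegral_mono_ae ?_
              filter_upwards [h₂] with y hy
              refine (hc x y).trans (le_of_eq ?_)
              rw [hx, hy]
          _ = c p + ε := by simp
    _ = ∫⁻ p, c p ∂N + ε := by
        rw [lintegral_add_right _ measurable_const]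
        simp

/-! ### Tensorization -/

theorem TransportEntropyInequality.prod_nat {F : Type*} [MeasurableSpace F]
    [StandardBorelSpace F] [Nonempty F] {c : ℕ × ℕ → ℝ≥0∞} {ω : F × F → ℝ≥0∞} {a₁ a₂ : ℝ≥0∞}
    {α : Measure ℕ} [IsProbabilityMeasure α] {ν : Measure F} [IsProbabilityMeasure ν]
    (hα : TransportEntropyInequality c a₁ a₂ α) (hν : TransportEntropyInequality ω a₁ a₂ ν) :
    TransportEntropyInequality
      (fun p : (ℕ × F) × (ℕ × F) => c (p.1.1, p.2.1) + ω (p.1.2, p.2.2)) a₁ a₂ (α.prod ν) := by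
  intro J₁ J₂ _ _
  have hk : ∀ (J : Measure (ℕ × F)) [IsProbabilityMeasure J],
      klDiv J.fst α + ∫⁻ i, klDiv (J.condKernel i) ν ∂J.fst ≤ klDiv J (α.prod ν) := by
    intro J _
    have h := klDiv_add_lintegral_klDiv_le J.fst α J.condKernel (Kernel.const ℕ ν)
    rwa [J.disintegrate J.condKernel, Measure.compProd_const] at h
  calc transportCost _ J₁ J₂
      = transportCost _ (J₁.fst ⊗ₘ J₁.condKernel) (J₂.fst ⊗ₘ J₂.condKernel) := by
        rw [J₁.disintegrate J₁.condKernel, J₂.disintegrate J₂.condKernel]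
    _ ≤ transportCost c J₁.fst J₂.fst + (∫⁻ i, a₁ * klDiv (J₁.condKernel i) ν ∂J₁.fst +
          ∫⁻ j, a₂ * klDiv (J₂.condKernel j) ν ∂J₂.fst) :=
        transportCost_compProd_le _ _ _ _ c ω _ _
          fun i j _ => hν _ _ inferInstance inferInstance
    _ ≤ (a₁ * klDiv J₁.fst α + a₂ * klDiv J₂.fst α) +
          (a₁ * ∫⁻ i, klDiv (J₁.condKernel i) ν ∂J₁.fst +
            a₂ * ∫⁻ j, klDiv (J₂.condKernel j) ν ∂J₂.fst) := by
        rw [lintegral_const_mul _ Measurable.of_discrete,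
          lintegral_const_mul _ Measurable.of_discrete]
        gcongr
        exact hα _ _ inferInstance inferInstance
    _ = a₁ * (klDiv J₁.fst α + ∫⁻ i, klDiv (J₁.condKernel i) ν ∂J₁.fst) +
          a₂ * (klDiv J₂.fst α + ∫⁻ j, klDiv (J₂.condKernel j) ν ∂J₂.fst) := by ring
    _ ≤ a₁ * klDiv J₁ (α.prod ν) + a₂ * klDiv J₂ (α.prod ν) := by
        gcongr
        · exact hk J₁
        · exact hk J₂

/-- A separable space has a countable measurable partition into sets of small diameter. -/
theorem exists_measurable_nat_edist_le (X : Type*) [PseudoEMetricSpace X] [MeasurableSpace X]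
    [OpensMeasurableSpace X] [TopologicalSpace.SeparableSpace X] {δ : ℝ≥0∞} (hδ : δ ≠ 0) :
    ∃ i : X → ℕ, Measurable i ∧ ∀ x y, i x = i y → edist x y ≤ δ := by
  classical
  cases isEmpty_or_nonempty X
  · exact ⟨fun _ => 0, measurable_const, fun x => isEmptyElim x⟩
  have hδ2 : 0 < δ / 2 := ENNReal.half_pos hδ
  have hex : ∀ x : X, ∃ n, x ∈ Metric.eball (TopologicalSpace.denseSeq X n) (δ / 2) := by
    intro x
    obtain ⟨n, hn⟩ := (TopologicalSpace.denseRange_denseSeq X).exists_mem_open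
      (Metric.isOpen_eball (x := x) (ε := δ / 2)) ⟨x, Metric.mem_eball_self hδ2⟩
    exact ⟨n, by rwa [Metric.mem_eball_comm]⟩
  refine ⟨fun x => Nat.find (hex x), measurable_find hex fun n => measurableSet_eball, ?_⟩
  intro x y h
  have hx := Nat.find_spec (hex x)
  have hy := Nat.find_spec (hex y)
  simp only at h
  rw [← h] at hy
  calc edist x y ≤ edist x _ + edist y _ := edist_triangle_right _ _ _
    _ ≤ δ / 2 + δ / 2 := add_le_add (le_of_lt hx) (le_of_lt hy)
    _ = δ := ENNReal.add_halves δ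

/-- Tensorization when the cost on the first factor is Lipschitz. The first factor is partitioned
into countably many small pieces, so that only countably many conditional laws occur and no
measurable choice of couplings is required. -/
theorem TransportEntropyInequality.prod_of_lipschitz {X F : Type*} [MetricSpace X]
    [CompleteSpace X] [TopologicalSpace.SeparableSpace X] [MeasurableSpace X] [BorelSpace X]
    [MeasurableSpace F] [StandardBorelSpace F] [Nonempty F] {f : X × X → ℝ≥0∞}
    {ω : F × F → ℝ≥0∞} {a₁ a₂ : ℝ≥0∞} (ha₁ : 0 < a₁) (ha₂ : 0 < a₂) {L : ℝ≥0}
    (hf : ∀ x y x' y', f (x, y) ≤ f (x', y') + L * (edist x x' + edist y y')) (hfm : Measurable f)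
    (hω : Measurable ω) {μ : Measure X} [IsProbabilityMeasure μ] {ν : Measure F}
    [IsProbabilityMeasure ν]
    (hμ : TransportEntropyInequality f a₁ a₂ μ) (hν : TransportEntropyInequality ω a₁ a₂ ν) :
    TransportEntropyInequality
      (fun p : (X × F) × (X × F) => f (p.1.1, p.2.1) + ω (p.1.2, p.2.2)) a₁ a₂ (μ.prod ν) := by
  intro Q₁ Q₂ _ _
  have hX : Nonempty X := nonempty_of_isProbabilityMeasure μ
  refine ENNReal.le_of_forall_pos_le_add fun ε hε _ => ?_
  set δ : ℝ≥0 := ε / (2 * (L + 1)) with hδ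
  have hδ0 : (δ : ℝ≥0∞) ≠ 0 := by
    have : 0 < δ := by positivity
    exact_mod_cast this.ne'
  have hLδ : (L : ℝ≥0∞) * (δ + δ) ≤ ε := by
    have : L * (δ + δ) ≤ ε := by
      have h1 : (L + 1) * (δ + δ) = ε := by rw [hδ]; field_simp; ring
      calc L * (δ + δ) ≤ (L + 1) * (δ + δ) := by gcongr; simp
        _ = ε := h1
    exact_mod_cast this
  obtain ⟨i, hi, hiδ⟩ := exists_measurable_nat_edist_le X hδ0
  let c : ℕ × ℕ → ℝ≥0∞ := fun p => ⨅ (x : X) (y : X) (_ : i x = p.1) (_ : i y = p.2), f (x, y)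
  have hcf : ∀ x y, c (i x, i y) ≤ f (x, y) := fun x y =>
    (iInf₂_le x y).trans ((iInf_le _ rfl).trans (iInf_le _ rfl))
  have hfc : ∀ x y, f (x, y) ≤ c (i x, i y) + ε := by
    intro x y
    simp only [c, ENNReal.iInf_add]
    refine le_iInf₂ fun x' y' => le_iInf₂ fun hx hy => (hf x y x' y').trans ?_
    gcongr
    refine le_trans ?_ hLδ
    gcongr
    · exact hiδ _ _ hx.symm
    · exact hiδ _ _ hy.symm
  have : IsProbabilityMeasure (μ.map i) := Measure.isProbabilityMeasure_map hi.aemeasurable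
  have hprod := (hμ.map ha₁ ha₂ hi hcf).prod_nat hν
  set g : X × F → ℕ × F := Prod.map i id with hg_def
  have hg : Measurable g := hi.prodMap measurable_id
  have hμg : (μ.map i).prod ν = (μ.prod ν).map g := by
    rw [hg_def, ← Measure.map_prod_map _ _ hi measurable_id, Measure.map_id]
  calc transportCost _ Q₁ Q₂
      ≤ transportCost (fun p : (ℕ × F) × (ℕ × F) => c (p.1.1, p.2.1) + ω (p.1.2, p.2.2))
          (Q₁.map g) (Q₂.map g) + ε := by
        refine transportCost_le_transportCost_map_add hg (by fun_prop) (fun z z' => ?_) Q₁ Q₂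
        calc f (z.1, z'.1) + ω (z.2, z'.2) ≤ c (i z.1, i z'.1) + ε + ω (z.2, z'.2) := by
              gcongr
              exact hfc _ _
          _ = c (i z.1, i z'.1) + ω (z.2, z'.2) + ε := by ring
    _ ≤ a₁ * klDiv (Q₁.map g) ((μ.map i).prod ν) +
          a₂ * klDiv (Q₂.map g) ((μ.map i).prod ν) + ε := by
        gcongr
        exact hprod _ _ (Measure.isProbabilityMeasure_map hg.aemeasurable)
          (Measure.isProbabilityMeasure_map hg.aemeasurable)
    _ ≤ a₁ * klDiv Q₁ (μ.prod ν) + a₂ * klDiv Q₂ (μ.prod ν) + ε := by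
        rw [hμg]
        gcongr
        · exact klDiv_map_le _ _ hg
        · exact klDiv_map_le _ _ hg

theorem TransportEntropyInequality.pi_of_lipschitz {X : Type*} [MetricSpace X]
    [CompleteSpace X] [TopologicalSpace.SeparableSpace X] [MeasurableSpace X] [BorelSpace X]
    {f : X × X → ℝ≥0∞} {a₁ a₂ : ℝ≥0∞} (ha₁ : 0 < a₁) (ha₂ : 0 < a₂) {L : ℝ≥0}
    (hf : ∀ x y x' y', f (x, y) ≤ f (x', y') + L * (edist x x' + edist y y')) (hfm : Measurable f)
    {μ : Measure X} [IsProbabilityMeasure μ] (hμ : TransportEntropyInequality f a₁ a₂ μ) (n : ℕ) :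
    TransportEntropyInequality
      (fun p : (Fin n → X) × (Fin n → X) => ∑ i, f (p.1 i, p.2 i)) a₁ a₂
      (Measure.pi fun _ => μ) := by
  have hX : Nonempty X := nonempty_of_isProbabilityMeasure μ
  induction n with
  | zero =>
    intro Q₁ Q₂ _ _
    refine (transportCost_le_of_isCoupling (IsCoupling.prod Q₁ Q₂)).trans ?_
    simp
  | succ n ih =>
    have hprod := TransportEntropyInequality.prod_of_lipschitz ha₁ ha₂ hf hfm
      (by fun_prop) hμ ih
    have hpres := (measurePreserving_piFinSuccAbove (fun _ : Fin (n + 1) => μ) 0).symm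
    rw [← hpres.map_eq]
    refine hprod.map ha₁ ha₂ hpres.measurable fun x y => ?_
    simp [Fin.sum_univ_succ, MeasurableEquiv.piFinSuccAbove]

/-! ### Monotone limits of costs -/

theorem isCompact_closure_setOf_isCoupling {E : Type*} [TopologicalSpace E] [PolishSpace E]
    [MeasurableSpace E] [BorelSpace E] (Q₁ Q₂ : Measure E) [IsFiniteMeasure Q₁]
    [IsFiniteMeasure Q₂] :
    IsCompact
      (closure {N : ProbabilityMeasure (E × E) | IsCoupling (N : Measure (E × E)) Q₁ Q₂}) := by
  refine isCompact_closure_of_isTightMeasureSet (IsTightMeasureSet.prodMk ?_ ?_)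
  · refine (isTightMeasureSet_singleton (μ := Q₁)).subset ?_
    rintro _ ⟨_, ⟨N, hN, rfl⟩, rfl⟩
    exact hN.1
  · refine (isTightMeasureSet_singleton (μ := Q₂)).subset ?_
    rintro _ ⟨_, ⟨N, hN, rfl⟩, rfl⟩
    exact hN.2

/-- Near-optimal couplings for the costs `f m` accumulate, by Prokhorov's theorem, at a coupling
that is near-optimal for their supremum. -/
theorem TransportEntropyInequality.iSup {E : Type*} [TopologicalSpace E] [PolishSpace E]
    [MeasurableSpace E] [BorelSpace E] {f : ℕ → BoundedContinuousFunction (E × E) ℝ≥0}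
    (hf : Monotone fun m p => f m p) {a₁ a₂ : ℝ≥0∞} {μ : Measure E}
    (h : ∀ m, TransportEntropyInequality (fun p => (f m p : ℝ≥0∞)) a₁ a₂ μ) :
    TransportEntropyInequality (fun p => ⨆ m, (f m p : ℝ≥0∞)) a₁ a₂ μ := by
  intro Q₁ Q₂ _ _
  set R := a₁ * klDiv Q₁ μ + a₂ * klDiv Q₂ μ
  refine ENNReal.le_of_forall_pos_le_add fun ε hε _ => ?_
  have hex : ∀ m, ∃ N : ProbabilityMeasure (E × E), IsCoupling (N : Measure (E × E)) Q₁ Q₂ ∧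
      ∫⁻ p, (f m p : ℝ≥0∞) ∂(N : Measure (E × E)) ≤ R + ε := by
    intro m
    obtain ⟨N, hN, hle⟩ := exists_isCoupling_lintegral_le (fun p => (f m p : ℝ≥0∞)) Q₁ Q₂
      (ENNReal.coe_ne_zero.2 hε.ne')
    exact ⟨⟨N, hN.isProbabilityMeasure⟩, hN, hle.trans (by gcongr; exact h m Q₁ Q₂ ‹_› ‹_›)⟩
  choose N hN hle using hex
  obtain ⟨M, -, hM⟩ := (isCompact_closure_setOf_isCoupling Q₁ Q₂).ultrafilter_le_nhds
    ((hyperfilter ℕ).map N) (tendsto_principal.2 (Eventually.of_forall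
      fun m => subset_closure (hN m)))
  have hM' : Tendsto N (hyperfilter ℕ) (𝓝 M) := hM
  have hMc : IsCoupling (M : Measure (E × E)) Q₁ Q₂ := by
    constructor
    · have h1 := (ProbabilityMeasure.continuous_map (continuous_fst (X := E) (Y := E))).tendsto M
        |>.comp hM'
      have h2 : (fun ν : ProbabilityMeasure (E × E) =>
            ν.map continuous_fst.measurable.aemeasurable) ∘ N
          = fun _ => (⟨Q₁, ‹_›⟩ : ProbabilityMeasure E) := by
        ext1 m
        exact Subtype.ext (hN m).1
      rw [h2] at h1
      exact congrArg (fun ν : ProbabilityMeasure E => (ν : Measure E))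
        (tendsto_nhds_unique h1 tendsto_const_nhds)
    · have h1 := (ProbabilityMeasure.continuous_map (continuous_snd (X := E) (Y := E))).tendsto M
        |>.comp hM'
      have h2 : (fun ν : ProbabilityMeasure (E × E) =>
            ν.map continuous_snd.measurable.aemeasurable) ∘ N
          = fun _ => (⟨Q₂, ‹_›⟩ : ProbabilityMeasure E) := by
        ext1 m
        exact Subtype.ext (hN m).2
      rw [h2] at h1
      exact congrArg (fun ν : ProbabilityMeasure E => (ν : Measure E))
        (tendsto_nhds_unique h1 tendsto_const_nhds)
  refine (transportCost_le_of_isCoupling hMc).trans ?_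
  rw [lintegral_iSup (f := fun m p => (f m p : ℝ≥0∞))
    (fun m => (ENNReal.continuous_coe.comp (f m).continuous).measurable)
    fun m n hmn p => ENNReal.coe_le_coe.2 (hf hmn p)]
  refine iSup_le fun m => le_of_tendsto
    (ProbabilityMeasure.tendsto_iff_forall_lintegral_tendsto.1 hM' (f m)) ?_
  have hge : ∀ᶠ k in (hyperfilter ℕ : Filter ℕ), m ≤ k :=
    (Nat.hyperfilter_le_atTop) (eventually_ge_atTop m)
  filter_upwards [hge] with k hk
  exact (lintegral_mono fun p => ENNReal.coe_le_coe.2 (hf hk p)).trans (hle k)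

/-! ### Lipschitz approximation of lower semicontinuous costs -/

/-- The inf-convolution of `min ρ m` with `m` times the distance: the largest `m`-Lipschitz
function below `min ρ m`. -/
noncomputable def lipschitzApprox {X : Type*} [PseudoEMetricSpace X] (ρ : X → ℝ≥0∞) (m : ℕ)
    (p : X) : ℝ≥0∞ :=
  ⨅ q, min (ρ q) m + m * edist p q

section LipschitzApprox

variable {X : Type*} [PseudoEMetricSpace X] (ρ : X → ℝ≥0∞)

theorem lipschitzApprox_le (m : ℕ) (p : X) : lipschitzApprox ρ m p ≤ min (ρ p) m :=
  (iInf_le _ p).trans (by simp)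

theorem lipschitzApprox_ne_top (m : ℕ) (p : X) : lipschitzApprox ρ m p ≠ ∞ :=
  ne_top_of_le_ne_top (ENNReal.natCast_ne_top m)
    ((lipschitzApprox_le ρ m p).trans (min_le_right _ _))

theorem lipschitzApprox_le_add (m : ℕ) (p q : X) :
    lipschitzApprox ρ m p ≤ lipschitzApprox ρ m q + m * edist p q := by
  simp only [lipschitzApprox, ENNReal.iInf_add]
  refine le_iInf fun r => (iInf_le _ r).trans ?_
  calc min (ρ r) m + m * edist p r ≤ min (ρ r) m + m * (edist p q + edist q r) := by
        gcongr
        exact edist_triangle _ _ _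
    _ = min (ρ r) m + m * edist q r + m * edist p q := by ring

theorem continuous_lipschitzApprox (m : ℕ) : Continuous (lipschitzApprox ρ m) :=
  continuous_of_le_add_edist m (ENNReal.natCast_ne_top m) (lipschitzApprox_le_add ρ m)

theorem monotone_lipschitzApprox : Monotone (lipschitzApprox ρ) := by
  intro m n hmn p
  refine iInf_mono fun q => ?_
  have : (m : ℝ≥0∞) ≤ n := by exact_mod_cast hmn
  gcongr

theorem iSup_lipschitzApprox (hρ : LowerSemicontinuous ρ) (p : X) :
    ⨆ m, lipschitzApprox ρ m p = ρ p := by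
  refine le_antisymm (iSup_le fun m => (lipschitzApprox_le ρ m p).trans (min_le_left _ _)) ?_
  refine le_of_forall_lt fun t ht => ?_
  obtain ⟨s, hts, hsp⟩ := exists_between ht
  refine hts.trans_le ?_
  obtain ⟨δ, hδ, hball⟩ := EMetric.mem_nhds_iff.1 (hρ p s hsp)
  have hs : s ≠ ∞ := hsp.ne_top
  obtain ⟨m₁, hm₁⟩ := ENNReal.exists_nat_gt hs
  obtain ⟨m₂, hm₂⟩ := ENNReal.exists_nat_mul_gt hδ.ne' hs
  refine le_trans ?_ (le_iSup _ (max m₁ m₂))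
  refine le_iInf fun q => ?_
  have h₁ : (m₁ : ℝ≥0∞) ≤ (max m₁ m₂ : ℕ) := by exact_mod_cast le_max_left _ _
  have h₂ : (m₂ : ℝ≥0∞) ≤ (max m₁ m₂ : ℕ) := by exact_mod_cast le_max_right _ _
  by_cases hq : edist p q < δ
  · refine le_add_right (le_min ?_ (hm₁.le.trans h₁))
    have : q ∈ Metric.eball p δ := by rwa [Metric.mem_eball, edist_comm]
    exact le_of_lt (hball this)
  · refine le_add_left (hm₂.le.trans ?_)
    gcongr
    exact not_lt.1 hq

/-- `lipschitzApprox` as a bounded continuous function. -/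
noncomputable def lipschitzApproxBCF (m : ℕ) : BoundedContinuousFunction X ℝ≥0 :=
  BoundedContinuousFunction.mkOfBound
    ⟨fun p => (lipschitzApprox ρ m p).toNNReal, continuous_iff_continuousAt.2 fun p =>
      (ENNReal.tendsto_toNNReal (lipschitzApprox_ne_top ρ m p)).comp
        (continuous_lipschitzApprox ρ m).continuousAt⟩ m (by
    have hb : ∀ p, (lipschitzApprox ρ m p).toNNReal ≤ m := fun p =>
      ENNReal.toNNReal_mono (ENNReal.natCast_ne_top m)
        ((lipschitzApprox_le ρ m p).trans (min_le_right _ _))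
    intro p q
    have hp : ((lipschitzApprox ρ m p).toNNReal : ℝ) ≤ m := by exact_mod_cast hb p
    have hq : ((lipschitzApprox ρ m q).toNNReal : ℝ) ≤ m := by exact_mod_cast hb q
    have hp0 := (lipschitzApprox ρ m p).toNNReal.coe_nonneg
    have hq0 := (lipschitzApprox ρ m q).toNNReal.coe_nonneg
    rw [NNReal.dist_eq, abs_le]
    constructor <;> simp only [ContinuousMap.coe_mk] <;> linarith)

@[simp]
theorem coe_lipschitzApproxBCF (m : ℕ) (p : X) :
    (lipschitzApproxBCF ρ m p : ℝ≥0∞) = lipschitzApprox ρ m p :=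
  ENNReal.coe_toNNReal (lipschitzApprox_ne_top ρ m p)

end LipschitzApprox

/-- Tensorization for a lower semicontinuous cost: the coordinatewise sum of the Lipschitz
approximations increases to the coordinatewise sum of the cost. -/
theorem TransportEntropyInequality.pi {X : Type*} [MetricSpace X]
    [CompleteSpace X] [TopologicalSpace.SeparableSpace X] [MeasurableSpace X] [BorelSpace X]
    {ρ : X × X → ℝ≥0∞} (hρ : LowerSemicontinuous ρ) {a₁ a₂ : ℝ≥0∞} (ha₁ : 0 < a₁) (ha₂ : 0 < a₂)
    {μ : Measure X} [IsProbabilityMeasure μ] (hμ : TransportEntropyInequality ρ a₁ a₂ μ) (n : ℕ) :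
    TransportEntropyInequality
      (fun p : (Fin n → X) × (Fin n → X) => ∑ i, ρ (p.1 i, p.2 i)) a₁ a₂
      (Measure.pi fun _ => μ) := by
  let f : ℕ → BoundedContinuousFunction ((Fin n → X) × (Fin n → X)) ℝ≥0 := fun m =>
    ∑ i, (lipschitzApproxBCF ρ m).compContinuous ⟨fun p => (p.1 i, p.2 i), by fun_prop⟩
  have hfe : ∀ m p, (f m p : ℝ≥0∞) = ∑ i, lipschitzApprox ρ m (p.1 i, p.2 i) := by
    intro m p
    simp [f, BoundedContinuousFunction.coe_sum]
  have hmono : Monotone fun m p => f m p := by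
    intro m k hmk p
    simp only [← ENNReal.coe_le_coe, hfe]
    exact Finset.sum_le_sum fun i _ => monotone_lipschitzApprox ρ hmk _
  have hsup : (fun p : (Fin n → X) × (Fin n → X) => ∑ i, ρ (p.1 i, p.2 i)) =
      fun p => ⨆ m, (f m p : ℝ≥0∞) := by
    ext p
    simp only [hfe]
    rw [← ENNReal.finsetSum_iSup_of_monotone
      fun i m k hmk => monotone_lipschitzApprox ρ hmk (p.1 i, p.2 i)]
    simp only [iSup_lipschitzApprox ρ hρ]
  rw [hsup]
  refine TransportEntropyInequality.iSup hmono fun m => ?_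
  simp only [hfe]
  refine TransportEntropyInequality.pi_of_lipschitz ha₁ ha₂ (L := m) (fun x y x' y' => ?_)
    (continuous_lipschitzApprox ρ m).measurable
    (hμ.mono fun p => (lipschitzApprox_le ρ m p).trans (min_le_left _ _)) n
  refine (lipschitzApprox_le_add ρ m (x, y) (x', y')).trans ?_
  rw [Prod.edist_eq, ENNReal.coe_natCast]
  gcongr
  exact max_le le_self_add le_add_self

/-! ### Configurations of points -/

namespace Configuration

/-- The number of points of a configuration. -/
noncomputable def mass {Z : Type*} [MeasurableSpace Z] (ξ : Configuration Z) : ℕ :=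
  ξ.2.choose

theorem coe_mass {Z : Type*} [MeasurableSpace Z] (ξ : Configuration Z) :
    (mass ξ : ℝ≥0∞) = ξ.toMeasure Set.univ := by
  obtain ⟨a, ha⟩ := ξ.2.choose_spec
  rw [toMeasure, ha]
  simp [mass]

theorem mass_ofPoints {Z : Type*} [MeasurableSpace Z] {k : ℕ} (a : Fin k → Z) :
    mass (ofPoints a) = k := by
  have h := coe_mass (ofPoints a)
  have h' : (ofPoints a).toMeasure = ∑ i, Measure.dirac (a i) := rfl
  rw [h'] at h
  simpa using h

theorem measurable_mass {Z : Type*} [TopologicalSpace Z] [MeasurableSpace Z]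
    [OpensMeasurableSpace Z] : Measurable (mass : Configuration Z → ℕ) := by
  have hc : Continuous fun ξ : Configuration Z => ξ.1.mass :=
    FiniteMeasure.continuous_mass.comp continuous_induced_dom
  refine measurable_to_countable' fun n => ?_
  have : mass ⁻¹' {n} = (fun ξ : Configuration Z => ξ.1.mass) ⁻¹' {(n : ℝ≥0)} := by
    ext ξ
    have h : (mass ξ : ℝ≥0∞) = (ξ.1.mass : ℝ≥0∞) := by
      rw [coe_mass, FiniteMeasure.ennreal_mass]
      rfl
    have h' : (mass ξ : ℝ≥0) = ξ.1.mass := by exact_mod_cast h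
    simp [← h']
  rw [this]
  exact hc.measurable (measurableSet_singleton _)

theorem setOf_toMeasure_univ_mem {Z : Type*} [MeasurableSpace Z] (A : Set ℕ) :
    {η : Configuration Z | η.toMeasure Set.univ ∈ (fun n : ℕ => (n : ℝ≥0∞)) '' A} =
      mass ⁻¹' A := by
  ext η
  simp [← coe_mass]

/-- Matching the points of two configurations in the given order is a coupling. -/
theorem transportCost_ofPoints_le {Z : Type*} [MeasurableSpace Z] {ρ : Z × Z → ℝ≥0∞}
    (hρ : Measurable ρ) {n : ℕ} (x y : Fin n → Z) :
    transportCost ρ (ofPoints x).toMeasure (ofPoints y).toMeasure ≤ ∑ i, ρ (x i, y i) := by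
  have h : IsCoupling (∑ i, Measure.dirac (x i, y i)) (ofPoints x).toMeasure
      (ofPoints y).toMeasure := by
    have hx : ∀ z : Fin n → Z, (ofPoints z).toMeasure = ∑ i, Measure.dirac (z i) := fun _ => rfl
    constructor
    · rw [Measure.map_finset_sum measurable_fst.aemeasurable, hx]
      simp [Measure.map_dirac' measurable_fst]
    · rw [Measure.map_finset_sum measurable_snd.aemeasurable, hx]
      simp [Measure.map_dirac' measurable_snd]
  refine (transportCost_le_of_isCoupling h).trans (le_of_eq ?_)
  rw [lintegral_finsetSum_measure]
  exact Finset.sum_congr rfl fun i _ => lintegral_dirac' _ hρ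

theorem transportCost_eq_top_of_mass_ne {Z : Type*} [MeasurableSpace Z] (ρ : Z × Z → ℝ≥0∞)
    {ξ₁ ξ₂ : Configuration Z} (h : mass ξ₁ ≠ mass ξ₂) :
    transportCost ρ ξ₁.toMeasure ξ₂.toMeasure = ∞ := by
  refine iInf₂_eq_top.2 fun N hN => (h ?_).elim
  have : (mass ξ₁ : ℝ≥0∞) = mass ξ₂ := by
    rw [coe_mass, coe_mass, ← hN.1, ← hN.2, Measure.map_apply measurable_fst MeasurableSet.univ,
      Measure.map_apply measurable_snd MeasurableSet.univ, Set.preimage_univ, Set.preimage_univ]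
  exact_mod_cast this

end Configuration

open Configuration

/-- Point processes at finite transport cost have the same law of the number of points, since a
coupling of finite cost charges only pairs of configurations with equally many points. -/
theorem map_mass_eq_of_processTransportCost_lt_top {Z : Type*} [TopologicalSpace Z]
    [MeasurableSpace Z] [OpensMeasurableSpace Z] {ρ : Z × Z → ℝ≥0∞}
    {P₁ P₂ : Measure (Configuration Z)} (hP : processTransportCost ρ P₁ P₂ < ∞) :
    P₁.map mass = P₂.map mass := by
  obtain ⟨N, hN⟩ := iInf_lt_iff.1 hP
  obtain ⟨hN, hlt⟩ := iInf_lt_iff.1 hN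
  have hm₁ : Measurable fun p : Configuration Z × Configuration Z => mass p.1 :=
    measurable_mass.comp measurable_fst
  have hm₂ : Measurable fun p : Configuration Z × Configuration Z => mass p.2 :=
    measurable_mass.comp measurable_snd
  have hS : MeasurableSet {p : Configuration Z × Configuration Z | mass p.1 ≠ mass p.2} :=
    (measurableSet_eq_fun hm₁ hm₂).compl
  have hzero : N {p | mass p.1 ≠ mass p.2} = 0 := by
    by_contra hne
    -- the cost is not known to be measurable, so its integral is bounded below by hand
    have hle : ∫⁻ p, Set.indicator {p : Configuration Z × Configuration Z | mass p.1 ≠ mass p.2}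
        (fun _ => ∞) p ∂N ≤ ∫⁻ ξ, transportCost ρ ξ.1.toMeasure ξ.2.toMeasure ∂N := by
      refine lintegral_mono fun p => ?_
      by_cases hp : mass p.1 = mass p.2
      · simp [hp]
      · simp [transportCost_eq_top_of_mass_ne ρ hp]
    rw [lintegral_indicator_const hS, ENNReal.top_mul hne] at hle
    exact absurd hlt (not_lt.2 hle)
  have hae : (fun p : Configuration Z × Configuration Z => mass p.1) =ᵐ[N] fun p => mass p.2 := by
    simpa [Filter.EventuallyEq, ae_iff] using hzero
  calc P₁.map mass = N.map fun p => mass p.1 := by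
        rw [← hN.1, Measure.map_map measurable_mass measurable_fst]
        rfl
    _ = N.map fun p => mass p.2 := Measure.map_congr hae
    _ = P₂.map mass := by
        rw [← hN.2, Measure.map_map measurable_mass measurable_snd]
        rfl

/-- Conditioning a law on a countable observable. On a null event the conditional law is
arbitrary; the law itself is taken, to have a Markov kernel. -/
theorem exists_map_prodMk_eq_compProd {E : Type*} [MeasurableSpace E] (P : Measure E)
    [IsProbabilityMeasure P] {i : E → ℕ} (hi : Measurable i) :
    ∃ K : Kernel ℕ E, IsMarkovKernel K ∧ P.map (fun x => (i x, x)) = P.map i ⊗ₘ K := by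
  classical
  let K : Kernel ℕ E :=
    Kernel.ofFunOfCountable fun n => if P (i ⁻¹' {n}) = 0 then P else P[|i ⁻¹' {n}]
  have hK : ∀ n, K n = if P (i ⁻¹' {n}) = 0 then P else P[|i ⁻¹' {n}] := fun n => rfl
  have hMarkov : IsMarkovKernel K := by
    refine ⟨fun n => ?_⟩
    rw [hK]
    split_ifs with h
    · infer_instance
    · exact cond_isProbabilityMeasure h
  have : IsProbabilityMeasure (P.map i) := Measure.isProbabilityMeasure_map hi.aemeasurable
  refine ⟨K, hMarkov, ?_⟩
  have him : Measurable fun x => (i x, x) := by fun_prop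
  ext s hs
  rw [Measure.compProd_apply hs, lintegral_countable', Measure.map_apply him hs]
  have hU : (fun x => (i x, x)) ⁻¹' s = ⋃ n, i ⁻¹' {n} ∩ Prod.mk n ⁻¹' s := by
    ext x
    simp
  rw [hU, measure_iUnion]
  · refine tsum_congr fun n => ?_
    rw [Measure.map_apply hi (measurableSet_singleton n), hK]
    split_ifs with h
    · rw [h, mul_zero]
      exact measure_mono_null Set.inter_subset_left h
    · rw [cond_apply (hi (measurableSet_singleton n)), mul_comm, ← mul_assoc,
        ENNReal.mul_inv_cancel h (measure_ne_top P _), one_mul]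
  · intro n m hnm
    refine Set.disjoint_left.2 fun x hx hx' => hnm ?_
    exact hx.1.symm.trans hx'.1
  · exact fun n => (hi (measurableSet_singleton n)).inter (measurable_prodMk_left hs)

/-! ### Binomial processes -/

/-- The laws of the binomial processes `∑ i < n, δ_{X i}` with `(X i)` i.i.d. of law `μ`, as a
kernel in `n`. -/
noncomputable def binomialKernel {Z : Type*} [TopologicalSpace Z] [MeasurableSpace Z]
    [OpensMeasurableSpace Z] (μ : Measure Z) [IsProbabilityMeasure μ] :
    Kernel ℕ (Configuration Z) :=
  Kernel.ofFunOfCountable fun n => (Measure.pi fun _ : Fin n => μ).map ofPoints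

theorem binomialKernel_apply {Z : Type*} [TopologicalSpace Z] [MeasurableSpace Z]
    [OpensMeasurableSpace Z] (μ : Measure Z) [IsProbabilityMeasure μ] (n : ℕ) :
    binomialKernel μ n = (Measure.pi fun _ : Fin n => μ).map ofPoints := rfl

theorem infinitePi_map_fin {Z : Type*} [MeasurableSpace Z] (μ : Measure Z)
    [IsProbabilityMeasure μ] (n : ℕ) :
    (Measure.infinitePi fun _ : ℕ => μ).map (fun x (i : Fin n) => x i) =
      Measure.pi fun _ : Fin n => μ := by
  refine (Measure.pi_eq fun s hs => ?_).symm
  let t : ℕ → Set Z := fun i => if h : i < n then s ⟨i, h⟩ else Set.univ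
  have ht : ∀ i : Fin n, t i = s i := fun i => by simp [t]
  have hpre : (fun (x : ℕ → Z) (i : Fin n) => x i) ⁻¹' Set.univ.pi s =
      (Finset.range n : Set ℕ).pi t := by
    ext x
    simp only [Set.mem_preimage, Set.mem_pi, Finset.coe_range, Set.mem_Iio]
    exact ⟨fun h i hi => (ht ⟨i, hi⟩).symm ▸ h ⟨i, hi⟩ (Set.mem_univ _),
      fun h i _ => ht i ▸ h i i.2⟩
  rw [Measure.map_apply (by fun_prop) (MeasurableSet.univ_pi hs), hpre, Measure.infinitePi_pi,
    Finset.prod_range]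
  · simp only [ht]
  · intro i hi
    exact ht ⟨i, Finset.mem_range.1 hi⟩ ▸ hs _

section Binomial

variable {Z : Type*} [TopologicalSpace Z] [SecondCountableTopology Z] [MeasurableSpace Z]
  [BorelSpace Z] (μ : Measure Z) [IsProbabilityMeasure μ]

theorem measurable_ofPoints (n : ℕ) : Measurable (ofPoints : (Fin n → Z) → Configuration Z) :=
  (continuous_ofPoints n).measurable

instance isMarkovKernel_binomialKernel : IsMarkovKernel (binomialKernel μ) :=
  ⟨fun n => Measure.isProbabilityMeasure_map (measurable_ofPoints n).aemeasurable⟩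

theorem mixedBinomial_map_mass (κ : Measure ℕ) [IsProbabilityMeasure κ] :
    (mixedBinomial μ κ).map (fun ξ => (mass ξ, ξ)) = κ ⊗ₘ binomialKernel μ := by
  have hm : Measurable fun ξ : Configuration Z => (mass ξ, ξ) :=
    measurable_mass.prodMk measurable_id
  have hcomp : Measurable ((fun ξ : Configuration Z => (mass ξ, ξ)) ∘ mixedBinomialMap) :=
    hm.comp measurable_mixedBinomialMap
  ext s hs
  rw [mixedBinomial, Measure.map_map hm measurable_mixedBinomialMap, Measure.map_apply hcomp hs,
    Measure.prod_apply (hcomp hs), Measure.compProd_apply hs]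
  refine lintegral_congr fun n => ?_
  have hs' : MeasurableSet (Prod.mk n ⁻¹' s) := measurable_prodMk_left hs
  rw [binomialKernel_apply, Measure.map_apply (measurable_ofPoints n) hs', ← infinitePi_map_fin,
    Measure.map_apply (by fun_prop) (measurable_ofPoints n hs')]
  congr 1
  ext x
  simp [mixedBinomialMap, mass_ofPoints]

end Binomial

theorem TransportEntropyInequality.binomialKernel {Z : Type*} [MetricSpace Z] [CompleteSpace Z]
    [TopologicalSpace.SeparableSpace Z] [MeasurableSpace Z] [BorelSpace Z]
    {μ : Measure Z} [IsProbabilityMeasure μ] {ρ : Z × Z → ℝ≥0∞} (hρ : LowerSemicontinuous ρ)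
    {a₁ a₂ : ℝ≥0∞} (ha₁ : 0 < a₁) (ha₂ : 0 < a₂) (hμ : TransportEntropyInequality ρ a₁ a₂ μ)
    (n : ℕ) :
    TransportEntropyInequality (fun ξ : Configuration Z × Configuration Z =>
      transportCost ρ ξ.1.toMeasure ξ.2.toMeasure) a₁ a₂ (binomialKernel μ n) :=
  (TransportEntropyInequality.pi hρ ha₁ ha₂ hμ n).map ha₁ ha₂ (measurable_ofPoints n)
    fun x y => transportCost_ofPoints_le hρ.measurable x y

/-! ### Mixed binomial processes -/

theorem theorem3p1 {Z : Type*} [MetricSpace Z] [CompleteSpace Z]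
    [TopologicalSpace.SeparableSpace Z] [MeasurableSpace Z] [BorelSpace Z]
    (κ : Measure ℕ) [IsProbabilityMeasure κ]
    (μ : Measure Z) [IsProbabilityMeasure μ]
    (ρ : Z × Z → ℝ≥0∞) (hρ : LowerSemicontinuous ρ)
    (a₁ a₂ : ℝ≥0∞) (ha₁ : 0 < a₁) (ha₂ : 0 < a₂)
    (hμ : TransportEntropyInequality ρ a₁ a₂ μ)
    (P₁ P₂ : Measure (Configuration Z)) [IsProbabilityMeasure P₁] [IsProbabilityMeasure P₂]
    (hP : processTransportCost ρ P₁ P₂ < ∞) :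
    ∃ l : Measure ℕ, IsProbabilityMeasure l ∧
      (∀ A : Set ℕ,
        P₁ {η | η.toMeasure Set.univ ∈ (fun n : ℕ => (n : ℝ≥0∞)) '' A} = l A ∧
        P₂ {η | η.toMeasure Set.univ ∈ (fun n : ℕ => (n : ℝ≥0∞)) '' A} = l A) ∧
      processTransportCost ρ P₁ P₂ + (a₁ + a₂) * InformationTheory.klDiv l κ ≤
        a₁ * InformationTheory.klDiv P₁ (mixedBinomial μ κ) +
          a₂ * InformationTheory.klDiv P₂ (mixedBinomial μ κ) := by
  have hle := map_mass_eq_of_processTransportCost_lt_top hP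
  set l := P₁.map mass with hl
  have hlp : IsProbabilityMeasure l := Measure.isProbabilityMeasure_map measurable_mass.aemeasurable
  refine ⟨l, hlp, fun A => ?_, ?_⟩
  · rw [setOf_toMeasure_univ_mem]
    constructor
    · rw [hl, Measure.map_apply measurable_mass (MeasurableSet.of_discrete)]
    · rw [hle, Measure.map_apply measurable_mass (MeasurableSet.of_discrete)]
  have hm : Measurable fun ξ : Configuration Z => (mass ξ, ξ) :=
    measurable_mass.prodMk measurable_id
  have hBp : IsProbabilityMeasure (mixedBinomial μ κ) :=
    Measure.isProbabilityMeasure_map measurable_mixedBinomialMap.aemeasurable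
  obtain ⟨K₁, _, hK₁⟩ := exists_map_prodMk_eq_compProd P₁ measurable_mass
  obtain ⟨K₂, _, hK₂⟩ := exists_map_prodMk_eq_compProd P₂ measurable_mass
  rw [← hl] at hK₁
  rw [← hle] at hK₂
  -- the relative entropies split into those of the numbers of points and of the conditional laws
  have hent : ∀ (P : Measure (Configuration Z)) [IsProbabilityMeasure P]
      (K : Kernel ℕ (Configuration Z)) [IsMarkovKernel K],
      P.map (fun ξ => (mass ξ, ξ)) = l ⊗ₘ K →
      klDiv l κ + ∫⁻ n, klDiv (K n) (binomialKernel μ n) ∂l ≤ klDiv P (mixedBinomial μ κ) := by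
    intro P _ K _ hPK
    refine (klDiv_add_lintegral_klDiv_le l κ K (binomialKernel μ)).trans ?_
    rw [← hPK, ← mixedBinomial_map_mass]
    exact klDiv_map_le _ _ hm
  have hsnd : ∀ (P : Measure (Configuration Z)) (K : Kernel ℕ (Configuration Z)),
      P.map (fun ξ => (mass ξ, ξ)) = l ⊗ₘ K → P = (l ⊗ₘ K).map Prod.snd := by
    intro P K hPK
    rw [← hPK, Measure.map_map measurable_snd hm]
    exact Measure.map_id.symm
  -- this cost forces the numbers of points to agree
  let c : ℕ × ℕ → ℝ≥0∞ := fun p => if p.1 = p.2 then 0 else ∞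
  have hc0 : transportCost c l l = 0 := by
    have hdiag : IsCoupling (l.map fun n => (n, n)) l l := by
      constructor
      · rw [Measure.map_map measurable_fst .of_discrete]
        exact Measure.map_id
      · rw [Measure.map_map measurable_snd .of_discrete]
        exact Measure.map_id
    refine le_antisymm ((transportCost_le_of_isCoupling hdiag).trans ?_) zero_le
    rw [lintegral_map .of_discrete .of_discrete]
    simp [c]
  have hT : processTransportCost ρ P₁ P₂ ≤
      a₁ * ∫⁻ n, klDiv (K₁ n) (binomialKernel μ n) ∂l +
        a₂ * ∫⁻ n, klDiv (K₂ n) (binomialKernel μ n) ∂l := by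
    have hglue := transportCost_compProd_le l l K₁ K₂ c
      (fun ξ : Configuration Z × Configuration Z =>
        transportCost ρ ξ.1.toMeasure ξ.2.toMeasure)
      (fun n => a₁ * klDiv (K₁ n) (binomialKernel μ n))
      (fun n => a₂ * klDiv (K₂ n) (binomialKernel μ n)) (fun i j hij => by
        obtain rfl : i = j := by
          by_contra hne
          exact hij (if_neg hne)
        exact hμ.binomialKernel hρ ha₁ ha₂ i _ _ inferInstance inferInstance)
    rw [hc0, zero_add, lintegral_const_mul _ .of_discrete, lintegral_const_mul _ .of_discrete]
      at hglue
    refine le_trans ?_ hglue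
    rw [processTransportCost]
    conv_lhs => rw [hsnd P₁ K₁ hK₁, hsnd P₂ K₂ hK₂]
    exact transportCost_map_le measurable_snd (fun x y => le_add_self) _ _
  calc processTransportCost ρ P₁ P₂ + (a₁ + a₂) * klDiv l κ
      ≤ (a₁ * ∫⁻ n, klDiv (K₁ n) (binomialKernel μ n) ∂l +
          a₂ * ∫⁻ n, klDiv (K₂ n) (binomialKernel μ n) ∂l) + (a₁ + a₂) * klDiv l κ := by gcongr
    _ = a₁ * (klDiv l κ + ∫⁻ n, klDiv (K₁ n) (binomialKernel μ n) ∂l) +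
          a₂ * (klDiv l κ + ∫⁻ n, klDiv (K₂ n) (binomialKernel μ n) ∂l) := by ring
    _ ≤ a₁ * klDiv P₁ (mixedBinomial μ κ) + a₂ * klDiv P₂ (mixedBinomial μ κ) := by
        gcongr
        · exact hent P₁ K₁ hK₁
        · exact hent P₂ K₂ hK₂
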